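/- Let $D\subseteq\mathbb{C}$ be a domain and write $\mathcal{M}(D)$ for the set of meromorphic functions on $D$. Locally uniform convergence of meromorphic functions is understood with respect to the spherical metric on $\mathbb{C}\cup\{\infty\}$. For $E\subseteq D$ put $E_D^{(0)}=E$ and, for $k\ge 1$, let $E_D^{(k)}$ be the set of all accumulation points in $D$ of $E_D^{(k-1)}$. For an integer $q\ge 0$, a family $\mathcal{F}\subseteq\mathcal{M}(D)$ is called $Q_q$-normal on $D$ if for each sequence $(g_n)_n$ in $\mathcal{F}$ there are a set $E\subseteq D$ with $E_D^{(q)}=\emptyset$ and a subsequence of $(g_n)_n$ that converges locally uniformly on $D\setminus E$ (the constant $\infty$ being allowed as a limit). Theorem. Let $m\ge 1$ be an integer and let $(f_n)_n$ be a sequence in $\mathcal{M}(D)$ such that $f_n^{(m)}\not\equiv 0$ for all $n$. Suppose that $(f_n^{(m+1)}/f_n^{(m)})_n$ converges locally uniformly on $D$ to some $F_m\in\mathcal{M}(D)$. Then for each $0\le j\le m$ the family $\{f_n^{(j+1)}/f_n^{(j)} : n\}$ is $Q_{m-j}$-normal on $D$. In particular, there exist a subsequence $(f_{n_k})_k$ of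 $(f_n)_n$ and an open and dense subset $U\subseteq D$ such that, for every $j=0,\dots,m$, the sequence $(f_{n_k}^{(j+1)}/f_{n_k}^{(j)})_k$ converges locally uniformly on $U$ to an analytic function on $U$. -/

import Mathlib

open Filter Topology Set

noncomputable section

namespace LogDerivLift

/-- The value in the Riemann sphere `ℂ ∪ {∞}` of a meromorphic function at `z`.
A meromorphic function is represented by a map `ℂ → ℂ` whose values at its poles (and possibly at
further isolated points) are irrelevant. Its true value at `z` is the limit of the map at `z`,
taken in the Riemann sphere over punctured neighbourhoods; at a pole this is `∞`. -/
def sphereValue (f : ℂ → ℂ) (z : ℂ) : OnePoint ℂ :=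
  limUnder (𝓝[≠] z) (fun w => (f w : OnePoint ℂ))

/-- The spherical (chordal) metric on the Riemann sphere. -/
def sphericalDist : OnePoint ℂ → OnePoint ℂ → ℝ
  | OnePoint.infty, OnePoint.infty => 0
  | OnePoint.infty, OnePoint.some w => 2 / √(1 + ‖w‖ ^ 2)
  | OnePoint.some z, OnePoint.infty => 2 / √(1 + ‖z‖ ^ 2)
  | OnePoint.some z, OnePoint.some w => 2 * ‖z - w‖ / (√(1 + ‖z‖ ^ 2) * √(1 + ‖w‖ ^ 2))

/-- Locally uniform convergence on `S`, with respect to the spherical metric, of the meromorphic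
functions `g n` to the sphere-valued map `G`. -/
def ConvergesLocallyUniformlyOn (g : ℕ → ℂ → ℂ) (G : ℂ → OnePoint ℂ) (S : Set ℂ) : Prop :=
  ∀ ε > 0, ∀ z ∈ S, ∃ V ∈ 𝓝[S] z, ∀ᶠ n in atTop, ∀ w ∈ V,
    sphericalDist (sphereValue (g n) w) (G w) < ε

/-- The derived set of order `k` of `E` with respect to `D`: iterate `k` times the operation of
taking the set of all accumulation points lying in `D`. -/
def derivedSetIn (D : Set ℂ) : ℕ → Set ℂ → Set ℂ
  | 0, E => E
  | k + 1, E => derivedSet (derivedSetIn D k E) ∩ D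

/-- `Q_m`-normality on `D` of a family of meromorphic functions on `D`. -/
def IsQNormal (m : ℕ) (D : Set ℂ) (𝓕 : Set (ℂ → ℂ)) : Prop :=
  (∀ g ∈ 𝓕, MeromorphicOn g D) ∧
  ∀ u : ℕ → ℂ → ℂ, (∀ n, u n ∈ 𝓕) →
    ∃ E ⊆ D, derivedSetIn D m E = ∅ ∧
      ∃ φ : ℕ → ℕ, StrictMono φ ∧
        ∃ G : ℂ → OnePoint ℂ, ConvergesLocallyUniformlyOn (fun k => u (φ k)) G (D \ E)

/-- The quotient `f^(j+1) / f^(j)`. -/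
def logDerivOfOrder (j : ℕ) (f : ℂ → ℂ) : ℂ → ℂ :=
  iteratedDeriv (j + 1) f / iteratedDeriv j f

end LogDerivLift

end

/-!
Write `L_j = f^(j+1) / f^(j)`. The limit of `L_j` is found by descending induction on `j`, starting
from the given limit `F` of `L_m`; no normality criterion is needed, because `L_(j-1)` can be
computed from `L_j` by integration.

Suppose `L_j` converges to a meromorphic function on `D \ E`, and add the poles of that limit to `E`,
so that the limit is holomorphic on the complement. On a small disc, with `h_n = f_n^(j-1)`, the
quotients `ℓ_n = h_n'' / h_n'` are then holomorphic for large `n` and converge uniformly on compact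
subsets. Let `Λ_n` be a primitive of `ℓ_n` and `K_n` a primitive of `exp Λ_n`, both vanishing at the
centre. They converge as well, and `h_n = b_n + c_n K_n` with `c_n ≠ 0`
(`exists_eq_add_mul_of_logDeriv_deriv`). Hence `h_n' / h_n` is the point
`[c_n exp Λ_n : b_n + c_n K_n]` of the sphere, which depends only on the ratio of `c_n` and `b_n`, so
`(c_n, b_n)` may be taken from the unit sphere of `ℂ × ℂ`. Along a subsequence on which these
parameters converge to `(c, b) ≠ 0`, both homogeneous coordinates converge, and the limits
`c exp Λ` and `b + c K` have no common zero. Since the spherical metric is continuous in homogeneous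
coordinates (`sphericalDist_projPoint`), `h_n' / h_n` converges spherically on the disc
(`exists_local_parameter`). Countably many discs cover the domain, and one subsequence serves them all
because a countable product of compact metric spaces is sequentially compact; the local limits agree
on overlaps (`exists_subseq_logDeriv_converges`).

The poles added to `E` accumulate in `D` only at points of `E`, so each step raises the order of the
exceptional set by at most one (`IsExceptional.exists_superset_poles`). Removing finally the poles of
the limit of `L_0` leaves an open dense set on which all the limits are holomorphic.
-/

noncomputable section

namespace LogDerivLift

/-! ### Values of meromorphic functions on the sphere -/

section SphereValue

variable {f g : ℂ → ℂ} {z : ℂ}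

theorem sphereValue_of_tendsto {c : ℂ} (h : Tendsto f (𝓝[≠] z) (𝓝 c)) : sphereValue f z = c :=
  Tendsto.limUnder_eq ((OnePoint.continuous_coe.tendsto c).comp h)

theorem sphereValue_of_tendsto_cobounded (h : Tendsto f (𝓝[≠] z) (Bornology.cobounded ℂ)) :
    sphereValue f z = OnePoint.infty := by
  rw [Metric.cobounded_eq_cocompact, ← coclosedCompact_eq_cocompact] at h
  exact Tendsto.limUnder_eq (OnePoint.tendsto_coe_infty.comp h)

theorem sphereValue_congr (h : f =ᶠ[𝓝[≠] z] g) : sphereValue f z = sphereValue g z := by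
  have : (fun w => (f w : OnePoint ℂ)) =ᶠ[𝓝[≠] z] fun w => (g w : OnePoint ℂ) := by
    filter_upwards [h] with w hw
    rw [hw]
  rw [sphereValue, sphereValue, limUnder, limUnder, map_congr this]

theorem sphereValue_of_continuousAt (h : ContinuousAt f z) : sphereValue f z = f z :=
  sphereValue_of_tendsto (h.tendsto.mono_left nhdsWithin_le_nhds)

theorem eventually_sphereValue_eq (h : MeromorphicAt f z) :
    ∀ᶠ w in 𝓝[≠] z, sphereValue f w = f w :=
  h.eventually_continuousAt.mono fun _ hw => sphereValue_of_continuousAt hw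

theorem tendsto_of_sphereValue_eq_coe (h : MeromorphicAt f z) {c : ℂ} (hc : sphereValue f z = c) :
    Tendsto f (𝓝[≠] z) (𝓝 c) := by
  rcases lt_or_ge (meromorphicOrderAt f z) 0 with ho | ho
  · rw [sphereValue_of_tendsto_cobounded (tendsto_cobounded_of_meromorphicOrderAt_neg ho)] at hc
    exact absurd hc (OnePoint.infty_ne_coe c)
  · obtain ⟨b, hb⟩ := tendsto_nhds_of_meromorphicOrderAt_nonneg h ho
    rw [sphereValue_of_tendsto hb, OnePoint.coe_eq_coe] at hc
    exact hc ▸ hb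

/-- The representative of a meromorphic function that takes the true value of the function at every
point which is not a pole, and the value `0` at the poles. -/
def regularize (f : ℂ → ℂ) (z : ℂ) : ℂ := (sphereValue f z).elim 0 id

theorem coe_regularize (h : sphereValue f z ≠ OnePoint.infty) :
    (regularize f z : OnePoint ℂ) = sphereValue f z := by
  obtain ⟨c, hc⟩ := OnePoint.ne_infty_iff_exists.mp h
  simp [regularize, ← hc]

theorem regularize_eventuallyEq (h : MeromorphicAt f z) : regularize f =ᶠ[𝓝[≠] z] f := by
  filter_upwards [eventually_sphereValue_eq h] with w hw
  simp [regularize, hw]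

theorem analyticAt_regularize (h : MeromorphicAt f z) (hz : sphereValue f z ≠ OnePoint.infty) :
    AnalyticAt ℂ (regularize f) z := by
  refine (h.congr (regularize_eventuallyEq h).symm).analyticAt ?_
  rw [continuousAt_iff_punctured_nhds]
  exact (tendsto_of_sphereValue_eq_coe h (coe_regularize hz).symm).congr'
    (regularize_eventuallyEq h).symm

theorem eventually_sphereValue_ne_infty (h : MeromorphicAt f z) :
    ∀ᶠ w in 𝓝[≠] z, sphereValue f w ≠ OnePoint.infty := by
  filter_upwards [eventually_sphereValue_eq h] with w hw
  rw [hw]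
  exact OnePoint.coe_ne_infty _

end SphereValue

/-! ### The spherical metric in homogeneous coordinates -/

/-- The point `[a : b]` of the Riemann sphere, that is `a / b` if `b ≠ 0`, and `∞` if `b = 0`.
The pair `(0, 0)` is sent to `∞` as well and has to be excluded in applications. -/
def projPoint (a b : ℂ) : OnePoint ℂ :=
  open Classical in if b = 0 then OnePoint.infty else ((a / b : ℂ) : OnePoint ℂ)

theorem sqrt_one_add_norm_div_sq {a b : ℂ} (hb : b ≠ 0) :
    √(1 + ‖a / b‖ ^ 2) = √(‖a‖ ^ 2 + ‖b‖ ^ 2) / ‖b‖ := by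
  have hb' : 0 < ‖b‖ := norm_pos_iff.mpr hb
  rw [eq_div_iff hb'.ne', ← Real.sqrt_sq hb'.le, ← Real.sqrt_mul (by positivity)]
  congr 1
  rw [Real.sqrt_sq hb'.le, norm_div]
  field_simp
  ring

/-- Clearing denominators in the definition of the spherical metric yields an expression that stays
continuous where a denominator vanishes. -/
theorem sphericalDist_projPoint {a b c d : ℂ} (h : a ≠ 0 ∨ b ≠ 0) (h' : c ≠ 0 ∨ d ≠ 0) :
    sphericalDist (projPoint a b) (projPoint c d) =
      2 * ‖a * d - c * b‖ / (√(‖a‖ ^ 2 + ‖b‖ ^ 2) * √(‖c‖ ^ 2 + ‖d‖ ^ 2)) := by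
  have pos {x y : ℂ} (hxy : x ≠ 0 ∨ y ≠ 0) : 0 < √(‖x‖ ^ 2 + ‖y‖ ^ 2) := by
    rw [Real.sqrt_pos]
    rcases hxy with hx | hx <;> have := norm_pos_iff.mpr hx <;> positivity
  have h1 := pos h
  have h2 := pos h'
  by_cases hb : b = 0 <;> by_cases hd : d = 0
  · simp [projPoint, hb, hd, sphericalDist]
  · have ha : a ≠ 0 := h.resolve_right (not_not.mpr hb)
    have := norm_pos_iff.mpr ha
    have := norm_pos_iff.mpr hd
    simp only [projPoint, hb, hd, if_true, if_false, sphericalDist, sqrt_one_add_norm_div_sq hd]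
    simp [Real.sqrt_sq]
    field_simp
  · have hc : c ≠ 0 := h'.resolve_right (not_not.mpr hd)
    have := norm_pos_iff.mpr hc
    have := norm_pos_iff.mpr hb
    simp only [projPoint, hb, hd, if_true, if_false, sphericalDist, sqrt_one_add_norm_div_sq hb]
    simp [Real.sqrt_sq]
    field_simp
  · have hb' := norm_pos_iff.mpr hb
    have hd' := norm_pos_iff.mpr hd
    simp only [projPoint, hb, hd, if_false, sphericalDist, sqrt_one_add_norm_div_sq hb,
      sqrt_one_add_norm_div_sq hd]
    rw [div_sub_div _ _ hb hd, norm_div, norm_mul, mul_comm b c]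
    field_simp

/-- A point at small spherical distance from a finite point `w` is finite, and it is close to `w`
in the plane, uniformly for bounded `w`. -/
theorem exists_norm_sub_lt_of_sphericalDist_lt {R ε : ℝ} (hR : 0 ≤ R) (hε : 0 < ε) :
    ∃ δ > 0, ∀ (x : OnePoint ℂ) (w : ℂ), ‖w‖ ≤ R → sphericalDist x w < δ →
      ∃ c : ℂ, x = c ∧ ‖c - w‖ < ε := by
  have hs : 0 < √(1 + R ^ 2) := by positivity
  -- with `s = √(1 + R²)`, a distance `< δ` gives `2‖c - w‖ < δ s (1 + R + ‖c - w‖)`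
  refine ⟨min 1 ε / (√(1 + R ^ 2) * (1 + R)), by positivity, fun x w hw hx => ?_⟩
  have hws : √(1 + ‖w‖ ^ 2) ≤ √(1 + R ^ 2) := by gcongr
  have hwpos : 0 < √(1 + ‖w‖ ^ 2) := by positivity
  rw [lt_div_iff₀ (by positivity)] at hx
  induction x using OnePoint.rec with
  | infty =>
    exfalso
    simp only [sphericalDist] at hx
    have h1 : 2 ≤ 2 / √(1 + ‖w‖ ^ 2) * (√(1 + R ^ 2) * (1 + R)) := by
      rw [div_mul_eq_mul_div, le_div_iff₀ hwpos]
      nlinarith [mul_nonneg hs.le hR]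
    linarith [min_le_left 1 ε]
  | coe c =>
    refine ⟨c, rfl, ?_⟩
    simp only [sphericalDist] at hx
    have hcpos : 0 < √(1 + ‖c‖ ^ 2) := by positivity
    have hc : √(1 + ‖c‖ ^ 2) ≤ 1 + R + ‖c - w‖ := by
      have : ‖c‖ ≤ ‖c - w‖ + ‖w‖ := by simpa using norm_add_le (c - w) w
      rw [Real.sqrt_le_left (by positivity)]
      nlinarith [norm_nonneg c, norm_nonneg (c - w)]
    have h0 := norm_nonneg (c - w)
    have key : 2 * ‖c - w‖ * (1 + R) < min 1 ε * (1 + R + ‖c - w‖) := by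
      have h1 : 2 * ‖c - w‖ * (1 + R) ≤ 2 * ‖c - w‖ / (√(1 + ‖c‖ ^ 2) * √(1 + ‖w‖ ^ 2)) *
          (√(1 + R ^ 2) * (1 + R)) * √(1 + ‖c‖ ^ 2) := by
        field_simp
        gcongr
      have h2 : 0 < min 1 ε := by positivity
      calc _ ≤ _ := h1
        _ < min 1 ε * √(1 + ‖c‖ ^ 2) := by gcongr
        _ ≤ _ := by gcongr
    have h3 : min 1 ε * ‖c - w‖ ≤ (1 + R) * ‖c - w‖ := by
      gcongr
      linarith [min_le_left 1 ε]
    have h4 : ‖c - w‖ * (1 + R) < min 1 ε * (1 + R) := by nlinarith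
    exact (lt_of_mul_lt_mul_right h4 (by positivity)).trans_le (min_le_right _ _)

/-- If `q' = p` and `p`, `q` have no common zero at `z`, the true value of `p / q` at `z` is
`[p z : q z]`. -/
theorem sphereValue_div_of_hasDerivAt {p q : ℂ → ℂ} {z : ℂ} (hp : ContinuousAt p z)
    (hq : HasDerivAt q (p z) z) (h : p z ≠ 0 ∨ q z ≠ 0) :
    sphereValue (p / q) z = projPoint (p z) (q z) := by
  by_cases hqz : q z = 0
  · have hpz : p z ≠ 0 := h.resolve_right (not_not.mpr hqz)
    rw [projPoint, if_pos hqz]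
    apply sphereValue_of_tendsto_cobounded
    have hq0 : Tendsto q (𝓝[≠] z) (𝓝[≠] 0) := by
      refine tendsto_nhdsWithin_iff.mpr ⟨?_, hq.eventually_ne hpz⟩
      simpa [hqz] using hq.continuousAt.tendsto.mono_left nhdsWithin_le_nhds
    rw [← tendsto_norm_atTop_iff_cobounded]
    have h1 := tendsto_norm_atTop_iff_cobounded.mpr (tendsto_inv₀_nhdsNE_zero.comp hq0)
    have h2 := (hp.norm.tendsto.mono_left (nhdsWithin_le_nhds (s := {z}ᶜ)))
    refine (h2.pos_mul_atTop (norm_pos_iff.mpr hpz) h1).congr fun w => ?_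
    simp [div_eq_mul_inv]
  · rw [projPoint, if_neg hqz]
    exact sphereValue_of_continuousAt (f := p / q) (hp.div hq.continuousAt hqz)

/-! ### Locally uniform convergence -/

namespace ConvergesLocallyUniformlyOn

variable {g : ℕ → ℂ → ℂ} {G : ℂ → OnePoint ℂ} {S T : Set ℂ}

theorem mono (h : ConvergesLocallyUniformlyOn g G S) (hT : T ⊆ S) :
    ConvergesLocallyUniformlyOn g G T := fun ε hε z hz =>
  let ⟨V, hV, hn⟩ := h ε hε z (hT hz)
  ⟨V, nhdsWithin_mono z hT hV, hn⟩

theorem comp_strictMono (h : ConvergesLocallyUniformlyOn g G S) {φ : ℕ → ℕ} (hφ : StrictMono φ) :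
    ConvergesLocallyUniformlyOn (fun k => g (φ k)) G S := fun ε hε z hz =>
  let ⟨V, hV, hn⟩ := h ε hε z hz
  ⟨V, hV, hφ.tendsto_atTop.eventually hn⟩

theorem congr_right (h : ConvergesLocallyUniformlyOn g G S) {H : ℂ → OnePoint ℂ}
    (hGH : ∀ z ∈ S, G z = H z) : ConvergesLocallyUniformlyOn g H S := fun ε hε z hz => by
  obtain ⟨V, hV, hn⟩ := h ε hε z hz
  refine ⟨V ∩ S, inter_mem hV self_mem_nhdsWithin, hn.mono fun n hn w hw => ?_⟩
  rw [← hGH w hw.2]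
  exact hn w hw.1

theorem of_forall_mem (h : ∀ z ∈ S, ∃ U, IsOpen U ∧ z ∈ U ∧ ConvergesLocallyUniformlyOn g G U) :
    ConvergesLocallyUniformlyOn g G S := fun ε hε z hz => by
  obtain ⟨U, hU, hzU, hconv⟩ := h z hz
  obtain ⟨V, hV, hn⟩ := hconv ε hε z hzU
  rw [hU.nhdsWithin_eq hzU] at hV
  exact ⟨V, mem_nhdsWithin_of_mem_nhds hV, hn⟩

theorem eventually_sphericalDist_lt (h : ConvergesLocallyUniformlyOn g G S) {z : ℂ} (hz : z ∈ S)
    {ε : ℝ} (hε : 0 < ε) : ∀ᶠ n in atTop, sphericalDist (sphereValue (g n) z) (G z) < ε := by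
  obtain ⟨V, hV, hn⟩ := h ε hε z hz
  exact hn.mono fun n hn => hn z (mem_of_mem_nhdsWithin hz hV)

/-- Near a point where the limit is finite, spherical convergence is convergence in the plane. -/
theorem eventually_norm_sub_lt {F : ℂ → ℂ}
    (h : ConvergesLocallyUniformlyOn g (fun z => (F z : OnePoint ℂ)) S) {z : ℂ} (hz : z ∈ S)
    (hS : IsOpen S) (hF : ContinuousAt F z) {ε : ℝ} (hε : 0 < ε) :
    ∀ᶠ y : ℕ × ℂ in atTop ×ˢ 𝓝 z,
      ∃ c : ℂ, sphereValue (g y.1) y.2 = c ∧ ‖c - F y.2‖ < ε := by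
  obtain ⟨δ, hδ, H⟩ := exists_norm_sub_lt_of_sphericalDist_lt (R := ‖F z‖ + 1) (by positivity) hε
  obtain ⟨V, hV, hn⟩ := h δ hδ z hz
  rw [hS.nhdsWithin_eq hz] at hV
  have hb : ∀ᶠ w in 𝓝 z, ‖F w‖ < ‖F z‖ + 1 := hF.norm.eventually_lt_const (by simp)
  filter_upwards [hn.prod_mk (hb.and hV)] with y hy
  exact H _ _ hy.2.1.le (hy.1 _ hy.2.2)

/-- A meromorphic limit is unique as a function with values in the sphere. -/
theorem sphereValue_unique {M₁ M₂ : ℂ → ℂ} (hS : IsOpen S) (h₁ : MeromorphicOn M₁ S)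
    (h₂ : MeromorphicOn M₂ S) (hg₁ : ConvergesLocallyUniformlyOn g (sphereValue M₁) S)
    (hg₂ : ConvergesLocallyUniformlyOn g (sphereValue M₂) S) {z : ℂ} (hz : z ∈ S) :
    sphereValue M₁ z = sphereValue M₂ z := by
  refine sphereValue_congr ?_
  filter_upwards [eventually_sphereValue_eq (h₁ z hz), eventually_sphereValue_eq (h₂ z hz),
    mem_nhdsWithin_of_mem_nhds (hS.mem_nhds hz)] with x hx₁ hx₂ hxS
  by_contra hne
  have hpos : 0 < ‖M₁ x - M₂ x‖ := norm_pos_iff.mpr (sub_ne_zero.mpr hne)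
  obtain ⟨δ, hδ, H⟩ := exists_norm_sub_lt_of_sphericalDist_lt (R := max ‖M₁ x‖ ‖M₂ x‖)
    (by positivity) (half_pos hpos)
  obtain ⟨n, hn₁, hn₂⟩ := ((hg₁.eventually_sphericalDist_lt hxS hδ).and
    (hg₂.eventually_sphericalDist_lt hxS hδ)).exists
  obtain ⟨c, hc, hc₁⟩ := H _ _ (le_max_left _ _) (hx₁ ▸ hn₁)
  obtain ⟨d, hd, hd₂⟩ := H _ _ (le_max_right _ _) (hx₂ ▸ hn₂)
  obtain rfl : c = d := OnePoint.coe_eq_coe.mp (hc ▸ hd)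
  have := norm_sub_le_norm_sub_add_norm_sub (M₁ x) c (M₂ x)
  rw [norm_sub_rev c] at hc₁
  linarith

/-- Meromorphic limits found near every point are the restrictions of one meromorphic limit. -/
theorem exists_meromorphicOn_of_locally
    (h : ∀ z ∈ S, ∃ U, IsOpen U ∧ z ∈ U ∧ ∃ M : ℂ → ℂ, MeromorphicOn M U ∧
      ConvergesLocallyUniformlyOn g (sphereValue M) U) :
    ∃ M : ℂ → ℂ, MeromorphicOn M S ∧ ConvergesLocallyUniformlyOn g (sphereValue M) S := by
  choose! U hU hzU M hM hconv using h
  choose! a ha haU using fun (w : ℂ) (hw : ∃ z ∈ S, w ∈ U z) => hw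
  have glue : ∀ z ∈ S, ∀ w ∈ U z, sphereValue (M (a w)) w = sphereValue (M z) w := by
    intro z hz w hw
    have hw' : ∃ z ∈ S, w ∈ U z := ⟨z, hz, hw⟩
    exact sphereValue_unique ((hU _ (ha w hw')).inter (hU z hz))
      ((hM _ (ha w hw')).mono_set inter_subset_left)
      ((hM z hz).mono_set inter_subset_right) ((hconv _ (ha w hw')).mono inter_subset_left)
      ((hconv z hz).mono inter_subset_right) ⟨haU w hw', hw⟩
  have hloc : ∀ z ∈ S, ∀ w ∈ U z, M z =ᶠ[𝓝[≠] w] fun w => regularize (M (a w)) w := by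
    intro z hz w hw
    filter_upwards [mem_nhdsWithin_of_mem_nhds ((hU z hz).mem_nhds hw),
      regularize_eventuallyEq (hM z hz w hw)] with x hx hx'
    rw [← hx', regularize, regularize, glue z hz x hx]
  refine ⟨fun w => regularize (M (a w)) w,
    fun z hz => (hM z hz z (hzU z hz)).congr (hloc z hz z (hzU z hz)), of_forall_mem fun z hz =>
    ⟨U z, hU z hz, hzU z hz, (hconv z hz).congr_right fun w hw =>
      sphereValue_congr (hloc z hz w hw)⟩⟩

/-- Convergence of homogeneous coordinates implies spherical convergence, because the limits of the
coordinates have no common zero. -/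
theorem of_projPoint {P Q : ℕ → ℂ → ℂ} {p q : ℂ → ℂ}
    (hg : ∀ᶠ n in atTop, ∀ w ∈ S, sphereValue (g n) w = projPoint (P n w) (Q n w))
    (hG : ∀ w ∈ S, G w = projPoint (p w) (q w))
    (hPQ : ∀ᶠ n in atTop, ∀ w ∈ S, P n w ≠ 0 ∨ Q n w ≠ 0) (hpq : ∀ w ∈ S, p w ≠ 0 ∨ q w ≠ 0)
    (hp : ∀ w ∈ S, ContinuousAt p w) (hq : ∀ w ∈ S, ContinuousAt q w)
    (hP : ∀ w ∈ S, Tendsto (fun y : ℕ × ℂ => P y.1 y.2) (atTop ×ˢ 𝓝 w) (𝓝 (p w)))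
    (hQ : ∀ w ∈ S, Tendsto (fun y : ℕ × ℂ => Q y.1 y.2) (atTop ×ˢ 𝓝 w) (𝓝 (q w))) :
    ConvergesLocallyUniformlyOn g G S := by
  intro ε hε z hz
  have hp' : Tendsto (fun y : ℕ × ℂ => p y.2) (atTop ×ˢ 𝓝 z) (𝓝 (p z)) :=
    (hp z hz).tendsto.comp tendsto_snd
  have hq' : Tendsto (fun y : ℕ × ℂ => q y.2) (atTop ×ˢ 𝓝 z) (𝓝 (q z)) :=
    (hq z hz).tendsto.comp tendsto_snd
  have hne : √(‖p z‖ ^ 2 + ‖q z‖ ^ 2) * √(‖p z‖ ^ 2 + ‖q z‖ ^ 2) ≠ 0 := by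
    have : 0 < ‖p z‖ ^ 2 + ‖q z‖ ^ 2 := by
      rcases hpq z hz with h | h <;> have := norm_pos_iff.mpr h <;> positivity
    positivity
  have hlim : Tendsto (fun y : ℕ × ℂ => 2 * ‖P y.1 y.2 * q y.2 - p y.2 * Q y.1 y.2‖ /
      (√(‖P y.1 y.2‖ ^ 2 + ‖Q y.1 y.2‖ ^ 2) * √(‖p y.2‖ ^ 2 + ‖q y.2‖ ^ 2)))
      (atTop ×ˢ 𝓝 z) (𝓝 0) := by
    have hn := ((((hP z hz).mul hq').sub (hp'.mul (hQ z hz))).norm.const_mul 2).div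
      (((((hP z hz).norm.pow 2).add ((hQ z hz).norm.pow 2)).sqrt).mul
        (((hp'.norm.pow 2).add (hq'.norm.pow 2)).sqrt)) hne
    simp only [sub_self, norm_zero, mul_zero, zero_div] at hn
    exact hn
  obtain ⟨A, hA, B, hB, H⟩ := eventually_prod_iff.mp (hlim.eventually_lt_const hε)
  refine ⟨{w | B w} ∩ S, inter_mem (mem_nhdsWithin_of_mem_nhds hB) self_mem_nhdsWithin, ?_⟩
  filter_upwards [hg, hPQ, hA] with n hgn hPQn hAn w hw
  rw [hgn w hw.2, hG w hw.2, sphericalDist_projPoint (hPQn w hw.2) (hpq w hw.2)]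
  exact H hAn hw.1

end ConvergesLocallyUniformlyOn

/-- For a continuous limit, locally uniform convergence is joint convergence in the index and the
point, which is preserved by continuous operations. -/
theorem tendstoLocallyUniformlyOn_iff_tendsto_prod {F : ℕ → ℂ → ℂ} {f : ℂ → ℂ} {S : Set ℂ}
    (hS : IsOpen S) (hf : ∀ z ∈ S, ContinuousAt f z) :
    TendstoLocallyUniformlyOn F f atTop S ↔
      ∀ z ∈ S, Tendsto (fun y : ℕ × ℂ => F y.1 y.2) (atTop ×ˢ 𝓝 z) (𝓝 (f z)) := by
  rw [hS.tendstoLocallyUniformlyOn_iff_forall_tendsto]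
  refine forall₂_congr fun z hz => ?_
  have hfz : Tendsto (fun y : ℕ × ℂ => f y.2) (atTop ×ˢ 𝓝 z) (𝓝 (f z)) :=
    (hf z hz).tendsto.comp tendsto_snd
  rw [tendsto_uniformity_iff_dist_tendsto_zero]
  exact ⟨fun h => hfz.congr_dist h, fun h => by simpa using hfz.dist h⟩

/-! ### Primitives -/

/-- Primitives with a common value at the centre converge if their derivatives do, by the mean value
inequality on smaller closed discs. -/
theorem tendstoLocallyUniformlyOn_of_hasDerivAt {f F : ℕ → ℂ → ℂ} {f₀ F₀ : ℂ → ℂ} {z : ℂ} {r : ℝ}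
    (hf : TendstoLocallyUniformlyOn f f₀ atTop (Metric.ball z r))
    (hF : ∀ n, ∀ w ∈ Metric.ball z r, HasDerivAt (F n) (f n w) w)
    (hF₀ : ∀ w ∈ Metric.ball z r, HasDerivAt F₀ (f₀ w) w) (hz : ∀ n, F n z = F₀ z) :
    TendstoLocallyUniformlyOn F F₀ atTop (Metric.ball z r) := by
  rw [Metric.tendstoLocallyUniformlyOn_iff]
  intro ε hε x hx
  have hr : 0 < r := dist_nonneg.trans_lt (Metric.mem_ball.mp hx)
  obtain ⟨ρ, hxρ, hρr⟩ := exists_between (Metric.mem_ball.mp hx)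
  have hsub : Metric.closedBall z ρ ⊆ Metric.ball z r := Metric.closedBall_subset_ball hρr
  have hunif := (tendstoLocallyUniformlyOn_iff_forall_isCompact Metric.isOpen_ball).mp hf _ hsub
    (isCompact_closedBall z ρ)
  rw [Metric.tendstoUniformlyOn_iff] at hunif
  refine ⟨Metric.closedBall z ρ, mem_nhdsWithin_of_mem_nhds
    (Metric.closedBall_mem_nhds_of_mem hxρ), ?_⟩
  filter_upwards [hunif (ε / r) (by positivity)] with n hn y hy
  have hd : ∀ w ∈ Metric.closedBall z ρ, HasDerivWithinAt (fun w => F₀ w - F n w) (f₀ w - f n w)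
      (Metric.closedBall z ρ) w := fun w hw =>
    ((hF₀ w (hsub hw)).sub (hF n w (hsub hw))).hasDerivWithinAt
  have hzρ : z ∈ Metric.closedBall z ρ :=
    Metric.mem_closedBall_self (dist_nonneg.trans hxρ.le)
  have := (convex_closedBall z ρ).norm_image_sub_le_of_norm_hasDerivWithin_le hd
    (fun w hw => by rw [← dist_eq_norm]; exact (hn w hw).le) hzρ hy
  rw [hz n, sub_self, sub_zero, ← dist_eq_norm, ← dist_eq_norm] at this
  calc _ ≤ ε / r * dist y z := this
    _ < ε / r * r := by
      gcongr
      exact (Metric.mem_closedBall.mp hy).trans_lt hρr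
    _ = ε := by field_simp

theorem meromorphicOrderAt_neg_of_sphereValue_eq_infty {f : ℂ → ℂ} {z : ℂ} (h : MeromorphicAt f z)
    (hz : sphereValue f z = OnePoint.infty) : meromorphicOrderAt f z < 0 := by
  by_contra! ho
  obtain ⟨b, hb⟩ := tendsto_nhds_of_meromorphicOrderAt_nonneg h ho
  exact OnePoint.coe_ne_infty b (sphereValue_of_tendsto hb ▸ hz)

/-- A meromorphic function with vanishing derivative is constant: it has no poles, since the
derivative would have poles there. -/
theorem exists_eventually_eq_const_of_deriv_eq_zero {k : ℂ → ℂ} {S : Set ℂ} (hS : IsOpen S)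
    (hS' : IsPreconnected S) (hk : MeromorphicOn k S)
    (hk' : ∀ w ∈ S, ∀ᶠ x in 𝓝[≠] w, deriv k x = 0) :
    ∃ c, ∀ w ∈ S, ∀ᶠ x in 𝓝[≠] w, k x = c := by
  have hreg : ∀ w ∈ S, AnalyticAt ℂ (regularize k) w := by
    intro w hw
    refine analyticAt_regularize (hk w hw) fun hinf => ?_
    have hneg := meromorphicOrderAt_neg_of_sphereValue_eq_infty (hk w hw) hinf
    obtain ⟨n, hn⟩ := WithTop.ne_top_iff_exists.mp hneg.ne_top
    have hn0 : (n : ℂ) ≠ 0 := by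
      rintro h0
      rw [Int.cast_eq_zero] at h0
      rw [← hn, h0] at hneg
      exact lt_irrefl _ hneg
    have := meromorphicOrderAt_deriv_eq_sub_one hn0 hn.symm
    rw [meromorphicOrderAt_eq_top_iff.mpr (hk' w hw)] at this
    exact WithTop.top_ne_coe this
  have hd : S.EqOn (deriv (regularize k)) 0 := by
    intro w hw
    have hev : deriv (regularize k) =ᶠ[𝓝[≠] w] 0 :=
      (regularize_eventuallyEq (hk w hw)).nhdsNE_deriv.trans (hk' w hw)
    exact ((ContinuousAt.eventuallyEq_nhds_iff_eventuallyEq_nhdsNE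
      (hreg w hw).deriv.continuousAt continuousAt_const).mp hev).eq_of_nhds
  obtain ⟨c, hc⟩ := hS.exists_is_const_of_deriv_eq_zero hS'
    (fun w hw => (hreg w hw).differentiableAt.differentiableWithinAt) hd
  refine ⟨c, fun w hw => ?_⟩
  filter_upwards [regularize_eventuallyEq (hk w hw), mem_nhdsWithin_of_mem_nhds (hS.mem_nhds hw)]
    with x hx hxS
  rw [← hx, hc x hxS]

/-! ### Solving `h'' / h' = ℓ` -/

section Solve

variable {S : Set ℂ} {ℓ Λ K h : ℂ → ℂ}

/-- If `Λ' = h'' / h'` and `K' = exp Λ`, then `h` is an affine function of `K`. -/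
theorem exists_eq_add_mul_of_logDeriv_deriv (hS : IsOpen S) (hS' : IsConnected S)
    (hh : MeromorphicOn h S) (hne : ∀ w ∈ S, ∀ᶠ x in 𝓝[≠] w, deriv h x ≠ 0)
    (hℓ : ∀ w ∈ S, ∀ᶠ x in 𝓝[≠] w, logDeriv (deriv h) x = ℓ x)
    (hΛ : ∀ w ∈ S, HasDerivAt Λ (ℓ w) w) (hK : ∀ w ∈ S, HasDerivAt K (Complex.exp (Λ w)) w) :
    ∃ c ≠ 0, ∃ b, ∀ w ∈ S, ∀ᶠ x in 𝓝[≠] w, h x = b + c * K x := by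
  have hSw : ∀ w ∈ S, ∀ᶠ x in 𝓝[≠] w, x ∈ S := fun w hw =>
    mem_nhdsWithin_of_mem_nhds (hS.mem_nhds hw)
  have han {f f' : ℂ → ℂ} (hf : ∀ w ∈ S, HasDerivAt f (f' w) w) : AnalyticOnNhd ℂ f S :=
    DifferentiableOn.analyticOnNhd
      (fun w hw => (hf w hw).differentiableAt.differentiableWithinAt) hS
  have hexp : AnalyticOnNhd ℂ (fun x => Complex.exp (-Λ x)) S := fun w hw =>
    (han hΛ w hw).fun_neg.cexp
  obtain ⟨c, hc⟩ := exists_eventually_eq_const_of_deriv_eq_zero (k := fun x =>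
    deriv h x * Complex.exp (-Λ x)) hS hS'.isPreconnected (hh.deriv.mul hexp.meromorphicOn) (by
      intro w hw
      filter_upwards [hne w hw, hℓ w hw, hSw w hw, (hh w hw).deriv.eventually_analyticAt]
        with x hx hℓx hxS hxan
      have := hxan.differentiableAt.hasDerivAt.mul (hΛ x hxS).fun_neg.cexp
      refine this.deriv.trans ?_
      rw [← hℓx, logDeriv_apply]
      field_simp
      ring)
  have hc' : ∀ w ∈ S, ∀ᶠ x in 𝓝[≠] w, deriv h x = c * Complex.exp (Λ x) := by
    intro w hw
    filter_upwards [hc w hw] with x hx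
    rw [← hx, mul_assoc, ← Complex.exp_add]
    simp
  have hc0 : c ≠ 0 := by
    obtain ⟨w, hw⟩ := hS'.nonempty
    obtain ⟨x, hx, hx'⟩ := ((hne w hw).and (hc' w hw)).exists
    rintro rfl
    simp [hx'] at hx
  obtain ⟨b, hb⟩ := exists_eventually_eq_const_of_deriv_eq_zero (k := fun x => h x - c * K x)
    hS hS'.isPreconnected (hh.sub ((MeromorphicOn.const c).mul (han hK).meromorphicOn)) (by
      intro w hw
      filter_upwards [hc' w hw, hSw w hw, (hh w hw).eventually_analyticAt] with x hx hxS hxan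
      have := hxan.differentiableAt.hasDerivAt.sub ((hK x hxS).const_mul c)
      refine this.deriv.trans ?_
      rw [hx, sub_self])
  refine ⟨c, hc0, b, fun w hw => ?_⟩
  filter_upwards [hb w hw] with x hx
  rw [← hx]
  ring

theorem ne_zero_or_ne_zero_of_mem_sphere {s : ℂ × ℂ} (hs : s ∈ Metric.sphere (0 : ℂ × ℂ) 1)
    (a b : ℂ) : s.1 * Complex.exp a ≠ 0 ∨ s.2 + s.1 * b ≠ 0 := by
  by_cases h1 : s.1 = 0
  · refine Or.inr ?_
    rw [h1, zero_mul, add_zero]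
    intro h2
    have : s = 0 := Prod.ext h1 h2
    simp [this] at hs
  · exact Or.inl (mul_ne_zero h1 (Complex.exp_ne_zero _))

theorem sphereValue_affine {s : ℂ × ℂ} (hs : s ∈ Metric.sphere (0 : ℂ × ℂ) 1) {w : ℂ}
    (hΛ : ContinuousAt Λ w) (hK : HasDerivAt K (Complex.exp (Λ w)) w) :
    sphereValue ((fun x => s.1 * Complex.exp (Λ x)) / fun x => s.2 + s.1 * K x) w =
      projPoint (s.1 * Complex.exp (Λ w)) (s.2 + s.1 * K w) :=
  sphereValue_div_of_hasDerivAt (by fun_prop) ((hK.const_mul s.1).const_add s.2)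
    (ne_zero_or_ne_zero_of_mem_sphere hs _ _)

/-- The logarithmic derivative of `h = b + c K` depends only on the ratio of `c` and `b`, which can
therefore be taken from a compact set. -/
theorem exists_mem_sphere_sphereValue_logDeriv (hS : IsOpen S) (hS' : IsConnected S)
    (hh : MeromorphicOn h S) (hne : ∀ w ∈ S, ∀ᶠ x in 𝓝[≠] w, deriv h x ≠ 0)
    (hℓ : ∀ w ∈ S, ∀ᶠ x in 𝓝[≠] w, logDeriv (deriv h) x = ℓ x)
    (hΛ : ∀ w ∈ S, HasDerivAt Λ (ℓ w) w) (hK : ∀ w ∈ S, HasDerivAt K (Complex.exp (Λ w)) w) :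
    ∃ s ∈ Metric.sphere (0 : ℂ × ℂ) 1, ∀ w ∈ S, sphereValue (logDeriv h) w =
      projPoint (s.1 * Complex.exp (Λ w)) (s.2 + s.1 * K w) := by
  obtain ⟨c, hc, b, hcb⟩ := exists_eq_add_mul_of_logDeriv_deriv hS hS' hh hne hℓ hΛ hK
  have hcb0 : ((c, b) : ℂ × ℂ) ≠ 0 := fun h0 => hc (congrArg Prod.fst h0)
  have hN : ‖((c, b) : ℂ × ℂ)‖ ≠ 0 := norm_ne_zero_iff.mpr hcb0
  set N : ℂ := (‖((c, b) : ℂ × ℂ)‖ : ℂ) with hNdef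
  have hN' : N ≠ 0 := Complex.ofReal_ne_zero.mpr hN
  have hs : N⁻¹ • ((c, b) : ℂ × ℂ) ∈ Metric.sphere (0 : ℂ × ℂ) 1 := by
    rw [mem_sphere_zero_iff_norm, norm_smul, norm_inv, hNdef, Complex.norm_real, norm_norm,
      inv_mul_cancel₀ hN]
  refine ⟨_, hs, fun w hw => ?_⟩
  rw [← sphereValue_affine hs (hΛ w hw).continuousAt (hK w hw)]
  refine sphereValue_congr ?_
  have hd : deriv h =ᶠ[𝓝[≠] w] deriv (fun x => b + c * K x) :=
    EventuallyEq.nhdsNE_deriv (hcb w hw)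
  filter_upwards [hcb w hw, hd, mem_nhdsWithin_of_mem_nhds (hS.mem_nhds hw)] with x hx hdx hxS
  rw [logDeriv_apply, hdx, hx, (((hK x hxS).const_mul c).const_add b).deriv]
  simp only [Pi.div_apply, Prod.smul_mk, smul_eq_mul]
  rw [mul_assoc, mul_assoc, ← mul_add, mul_div_mul_left _ _ (inv_ne_zero hN')]

end Solve

/-! ### Lowering the order of differentiation by one -/

section Lift

variable {Ω : Set ℂ} {h : ℕ → ℂ → ℂ} {F : ℂ → ℂ}

/-- Near each point, the only obstruction to the convergence of `h' / h` is the convergence of a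
sequence in a compact set. -/
theorem exists_local_parameter (hΩ : IsOpen Ω) (hh : ∀ n, MeromorphicOn (h n) Ω)
    (hne : ∀ n, ∀ w ∈ Ω, ∀ᶠ x in 𝓝[≠] w, deriv (h n) x ≠ 0) (hF : AnalyticOnNhd ℂ F Ω)
    (hconv : ConvergesLocallyUniformlyOn (fun n => logDeriv (deriv (h n)))
      (fun z => (F z : OnePoint ℂ)) Ω) {z : ℂ} (hz : z ∈ Ω) :
    ∃ U, IsOpen U ∧ z ∈ U ∧ ∃ s : ℕ → ℂ × ℂ, (∀ n, s n ∈ Metric.sphere (0 : ℂ × ℂ) 1) ∧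
      ∀ φ : ℕ → ℕ, StrictMono φ → ∀ p, Tendsto (s ∘ φ) atTop (𝓝 p) →
        ∃ M : ℂ → ℂ, MeromorphicOn M U ∧
          ConvergesLocallyUniformlyOn (fun k => logDeriv (h (φ k))) (sphereValue M) U := by
  obtain ⟨A, hA, B, hB, hAB⟩ := eventually_prod_iff.mp
    (hconv.eventually_norm_sub_lt hz hΩ (hF z hz).continuousAt one_pos)
  obtain ⟨N, hN⟩ := eventually_atTop.mp hA
  obtain ⟨r, hr, hrU⟩ := Metric.mem_nhds_iff.mp (inter_mem hB (hΩ.mem_nhds hz))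
  set U := Metric.ball z r with hU
  have hUo : IsOpen U := Metric.isOpen_ball
  have hUc : IsConnected U := (convex_ball z r).isConnected ⟨z, Metric.mem_ball_self hr⟩
  have hUΩ : U ⊆ Ω := fun w hw => (hrU hw).2
  have hfin : ∀ n ≥ N, ∀ w ∈ U, sphereValue (logDeriv (deriv (h n))) w ≠ OnePoint.infty := by
    intro n hn w hw
    obtain ⟨c, hc, -⟩ := hAB (hN n hn) (hrU hw).1
    exact hc ▸ OnePoint.coe_ne_infty c
  have hLmer : ∀ n, MeromorphicOn (logDeriv (deriv (h n))) Ω := fun n =>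
    (hh n).deriv.deriv.div (hh n).deriv
  -- the first `N` terms are irrelevant for the limit and may be replaced
  set ℓ : ℕ → ℂ → ℂ := fun n => if N ≤ n then regularize (logDeriv (deriv (h n))) else F with hℓdef
  have hℓN : ∀ n ≥ N, ℓ n = regularize (logDeriv (deriv (h n))) := fun n hn => if_pos hn
  have hℓan : ∀ n, AnalyticOnNhd ℂ (ℓ n) U := by
    intro n w hw
    by_cases hn : N ≤ n
    · rw [hℓN n hn]
      exact analyticAt_regularize (hLmer n w (hUΩ hw)) (hfin n hn w hw)
    · simp only [hℓdef, if_neg hn]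
      exact hF w (hUΩ hw)
  have hFU : AnalyticOnNhd ℂ F U := hF.mono hUΩ
  have hℓlim : TendstoLocallyUniformlyOn ℓ F atTop U := by
    rw [hUo.tendstoLocallyUniformlyOn_iff_forall_tendsto]
    intro w hw
    rw [tendsto_uniformity_iff_dist_tendsto_zero, Metric.tendsto_nhds]
    intro ε hε
    filter_upwards [hconv.eventually_norm_sub_lt (hUΩ hw) hΩ (hFU w hw).continuousAt hε,
      (eventually_ge_atTop N).prod_inl (𝓝 w)] with y hy hyN
    obtain ⟨c, hc, hc'⟩ := hy
    simpa [hℓN _ hyN, regularize, hc, dist_eq_norm, norm_sub_rev (F _)] using hc'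
  have prim {f : ℂ → ℂ} (hf : AnalyticOnNhd ℂ f U) :
      ∃ g, g z = 0 ∧ ∀ x ∈ U, HasDerivAt g (f x) x :=
    hf.differentiableOn.isExactOn_ball.with_val_at z 0
  have primexp {f g : ℂ → ℂ} (hfg : ∀ x ∈ U, HasDerivAt g (f x) x) :
      AnalyticOnNhd ℂ (fun x => Complex.exp (g x)) U := fun w hw =>
    (DifferentiableOn.analyticOnNhd
      (fun w hw => (hfg w hw).differentiableAt.differentiableWithinAt) hUo w hw).cexp
  -- `Λ n` and `K n` vanish at the centre, `Λ n` is a primitive of `ℓ n`, `K n` one of `exp (Λ n)`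
  choose Λ hΛz hΛ using fun n => prim (hℓan n)
  obtain ⟨Λ₀, hΛ₀z, hΛ₀⟩ := prim hFU
  choose K hKz hK using fun n => prim (primexp (hΛ n))
  obtain ⟨K₀, hK₀z, hK₀⟩ := prim (primexp hΛ₀)
  have hΛlim := tendstoLocallyUniformlyOn_of_hasDerivAt hℓlim hΛ hΛ₀ (by simp [hΛz, hΛ₀z])
  have hΛ₀c : ∀ w ∈ U, ContinuousAt Λ₀ w := fun w hw => (hΛ₀ w hw).continuousAt
  have hK₀c : ∀ w ∈ U, ContinuousAt K₀ w := fun w hw => (hK₀ w hw).continuousAt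
  have hEc : ∀ w ∈ U, ContinuousAt (fun x => Complex.exp (Λ₀ x)) w := fun w hw =>
    (hΛ₀c w hw).cexp
  have hElim : TendstoLocallyUniformlyOn (fun n x => Complex.exp (Λ n x))
      (fun x => Complex.exp (Λ₀ x)) atTop U := by
    rw [tendstoLocallyUniformlyOn_iff_tendsto_prod hUo hEc]
    rw [tendstoLocallyUniformlyOn_iff_tendsto_prod hUo hΛ₀c] at hΛlim
    exact fun w hw => (hΛlim w hw).cexp
  have hKlim := tendstoLocallyUniformlyOn_of_hasDerivAt hElim hK hK₀ (by simp [hKz, hK₀z])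
  rw [tendstoLocallyUniformlyOn_iff_tendsto_prod hUo hEc] at hElim
  rw [tendstoLocallyUniformlyOn_iff_tendsto_prod hUo hK₀c] at hKlim
  have hs : ∀ n, ∃ s ∈ Metric.sphere (0 : ℂ × ℂ) 1, N ≤ n → ∀ w ∈ U,
      sphereValue (logDeriv (h n)) w =
        projPoint (s.1 * Complex.exp (Λ n w)) (s.2 + s.1 * K n w) := by
    intro n
    by_cases hn : N ≤ n
    · obtain ⟨s, hs, hs'⟩ := exists_mem_sphere_sphereValue_logDeriv hUo hUc
        ((hh n).mono_set hUΩ) (fun w hw => hne n w (hUΩ hw)) (fun w hw => by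
          rw [hℓN n hn]
          exact (regularize_eventuallyEq (hLmer n w (hUΩ hw))).symm) (hΛ n) (hK n)
      exact ⟨s, hs, fun _ => hs'⟩
    · exact ⟨(1, 0), by simp [Prod.norm_def], fun hn' => absurd hn' hn⟩
  choose s hs hsval using hs
  refine ⟨U, hUo, Metric.mem_ball_self hr, s, hs, fun φ hφ p hp => ?_⟩
  have hpS : p ∈ Metric.sphere (0 : ℂ × ℂ) 1 :=
    Metric.isClosed_sphere.mem_of_tendsto hp (Eventually.of_forall fun k => hs (φ k))
  have hφN : ∀ᶠ k in atTop, N ≤ φ k := hφ.tendsto_atTop.eventually_ge_atTop N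
  have hp1 (w : ℂ) : Tendsto (fun y : ℕ × ℂ => (s (φ y.1)).1) (atTop ×ˢ 𝓝 w) (𝓝 p.1) :=
    ((continuous_fst.tendsto p).comp hp).comp tendsto_fst
  have hp2 (w : ℂ) : Tendsto (fun y : ℕ × ℂ => (s (φ y.1)).2) (atTop ×ˢ 𝓝 w) (𝓝 p.2) :=
    ((continuous_snd.tendsto p).comp hp).comp tendsto_fst
  have hsub (w : ℂ) : Tendsto (fun y : ℕ × ℂ => (φ y.1, y.2)) (atTop ×ˢ 𝓝 w) (atTop ×ˢ 𝓝 w) :=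
    (hφ.tendsto_atTop.comp tendsto_fst).prodMk tendsto_snd
  refine ⟨(fun x => p.1 * Complex.exp (Λ₀ x)) / fun x => p.2 + p.1 * K₀ x,
    MeromorphicOn.div ((MeromorphicOn.const _).mul (primexp hΛ₀).meromorphicOn)
      ((MeromorphicOn.const _).add ((MeromorphicOn.const _).mul
        (DifferentiableOn.analyticOnNhd
          (fun w hw => (hK₀ w hw).differentiableAt.differentiableWithinAt) hUo).meromorphicOn)),
    ConvergesLocallyUniformlyOn.of_projPoint
      (P := fun k x => (s (φ k)).1 * Complex.exp (Λ (φ k) x))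
      (Q := fun k x => (s (φ k)).2 + (s (φ k)).1 * K (φ k) x)
      (hφN.mono fun k hk => hsval (φ k) hk)
      (fun w hw => sphereValue_affine hpS (hΛ₀c w hw) (hK₀ w hw))
      (Eventually.of_forall fun k w _ => ne_zero_or_ne_zero_of_mem_sphere (hs (φ k)) _ _)
      (fun w _ => ne_zero_or_ne_zero_of_mem_sphere hpS _ _)
      (fun w hw => (hEc w hw).const_mul _)
      (fun w hw => ((hK₀c w hw).const_mul _).const_add _)
      (fun w hw => (hp1 w).mul ((hElim w hw).comp (hsub w)))
      (fun w hw => (hp2 w).add ((hp1 w).mul ((hKlim w hw).comp (hsub w))))⟩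

/-- If `h'' / h'` converges to a holomorphic function, then a subsequence of `h' / h` converges to a
meromorphic function. -/
theorem exists_subseq_logDeriv_converges (hΩ : IsOpen Ω) (hh : ∀ n, MeromorphicOn (h n) Ω)
    (hne : ∀ n, ∀ w ∈ Ω, ∀ᶠ x in 𝓝[≠] w, deriv (h n) x ≠ 0) (hF : AnalyticOnNhd ℂ F Ω)
    (hconv : ConvergesLocallyUniformlyOn (fun n => logDeriv (deriv (h n)))
      (fun z => (F z : OnePoint ℂ)) Ω) :
    ∃ φ : ℕ → ℕ, StrictMono φ ∧ ∃ M : ℂ → ℂ, MeromorphicOn M Ω ∧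
      ConvergesLocallyUniformlyOn (fun k => logDeriv (h (φ k))) (sphereValue M) Ω := by
  choose! U hU hzU s hs hlim using fun z (hz : z ∈ Ω) =>
    exists_local_parameter hΩ hh hne hF hconv hz
  obtain ⟨t, htΩ, htc, hcover⟩ := TopologicalSpace.countable_cover_nhdsWithin (f := U) (s := Ω)
    fun z hz => mem_nhdsWithin_of_mem_nhds ((hU z hz).mem_nhds (hzU z hz))
  have : Countable t := htc.to_subtype
  -- countably many parameters are made convergent at once
  obtain ⟨p, -, φ, hφ, hp⟩ := (isCompact_univ_pi fun _ : t =>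
    isCompact_sphere (0 : ℂ × ℂ) 1).tendsto_subseq (x := fun n (z : t) => s z n)
      fun n z _ => hs z (htΩ z.2) n
  refine ⟨φ, hφ, ConvergesLocallyUniformlyOn.exists_meromorphicOn_of_locally fun z hz => ?_⟩
  obtain ⟨w, hw, hzw⟩ := mem_iUnion₂.mp (hcover hz)
  exact ⟨U w, hU w (htΩ hw), hzw, hlim w (htΩ hw) φ hφ (p ⟨w, hw⟩)
    (tendsto_pi_nhds.mp hp ⟨w, hw⟩)⟩

end Lift

/-! ### Derived sets and exceptional sets -/

section Exceptional

variable {D E : Set ℂ} {k : ℕ}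

theorem derivedSetIn_mono {A B : Set ℂ} (h : A ⊆ B) : derivedSetIn D k A ⊆ derivedSetIn D k B := by
  induction k with
  | zero => exact h
  | succ k ih => exact inter_subset_inter_left _ (derivedSet_mono _ _ ih)

theorem derivedSetIn_succ_eq (A : Set ℂ) :
    derivedSetIn D (k + 1) A = derivedSetIn D k (derivedSet A ∩ D) := by
  induction k with
  | zero => rfl
  | succ k ih => rw [derivedSetIn, ih, derivedSetIn]

theorem derivedSetIn_empty : derivedSetIn D k ∅ = ∅ := by
  induction k with
  | zero => rfl
  | succ k ih =>
    rw [derivedSetIn, ih]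
    refine eq_empty_of_forall_notMem fun x hx => ?_
    simpa using accPt_iff_frequently_nhdsNE.mp (mem_derivedSet.mp hx.1)

/-- A relatively closed subset of `D` with dense complement, whose derived set of order `k` is
empty. -/
structure IsExceptional (D : Set ℂ) (k : ℕ) (E : Set ℂ) : Prop where
  subset : E ⊆ D
  isOpen_diff : IsOpen (D \ E)
  subset_closure : D ⊆ closure (D \ E)
  derivedSetIn_eq : derivedSetIn D k E = ∅

/-- Adding the poles of a function meromorphic off `E` increases the order by at most one: the poles
accumulate in `D` only at points of `E`. -/
theorem IsExceptional.exists_superset_poles (hE : IsExceptional D k E) {M : ℂ → ℂ}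
    (hM : MeromorphicOn M (D \ E)) :
    ∃ E', E ⊆ E' ∧ IsExceptional D (k + 1) E' ∧
      ∀ z ∈ D \ E', sphereValue M z ≠ OnePoint.infty := by
  set E' := E ∪ {z ∈ D | sphereValue M z = OnePoint.infty} with hE'
  have hEE' : E ⊆ E' := subset_union_left
  have key : ∀ z ∈ D \ E, ∀ᶠ w in 𝓝[≠] z, w ∈ D \ E' := by
    intro z hz
    filter_upwards [mem_nhdsWithin_of_mem_nhds (hE.isOpen_diff.mem_nhds hz),
      eventually_sphereValue_ne_infty (hM z hz)] with w hw hw'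
    exact ⟨hw.1, fun h => h.elim hw.2 fun h => hw' h.2⟩
  refine ⟨E', hEE', ⟨union_subset hE.subset (sep_subset _ _), ?_, ?_, ?_⟩,
    fun z hz h => hz.2 (Or.inr ⟨hz.1, h⟩)⟩
  · rw [isOpen_iff_mem_nhds]
    intro z hz
    have := key z ⟨hz.1, fun h => hz.2 (hEE' h)⟩
    rw [eventually_nhdsWithin_iff] at this
    filter_upwards [this] with w hw
    by_cases hwz : w = z
    · exact hwz ▸ hz
    · exact hw hwz
  · refine hE.subset_closure.trans (closure_minimal (fun z hz => ?_) isClosed_closure)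
    exact mem_closure_iff_frequently.mpr
      ((key z hz).frequently.filter_mono nhdsWithin_le_nhds)
  · rw [derivedSetIn_succ_eq, ← subset_empty_iff, ← hE.derivedSetIn_eq]
    refine derivedSetIn_mono fun z hz => ?_
    by_contra hzE
    have hacc := accPt_iff_frequently_nhdsNE.mp (mem_derivedSet.mp hz.1)
    exact hacc ((key z ⟨hz.2, hzE⟩).mono fun w hw => hw.2)

theorem isExceptional_empty (hD : IsOpen D) : IsExceptional D k ∅ where
  subset := empty_subset D
  isOpen_diff := by rwa [sdiff_empty]
  subset_closure := by rw [sdiff_empty]; exact subset_closure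
  derivedSetIn_eq := derivedSetIn_empty

end Exceptional

/-! ### Iterated derivatives -/

section IteratedDeriv

variable {D : Set ℂ} {f : ℂ → ℂ}

theorem meromorphicOn_iteratedDeriv (hf : MeromorphicOn f D) (j : ℕ) :
    MeromorphicOn (iteratedDeriv j f) D := by
  rw [iteratedDeriv_eq_iterate]
  exact hf.iterated_deriv

theorem logDerivOfOrder_eq (j : ℕ) (f : ℂ → ℂ) :
    logDerivOfOrder j f = logDeriv (iteratedDeriv j f) := by
  rw [logDerivOfOrder, iteratedDeriv_succ]
  rfl

theorem eventually_ne_zero_of_deriv {z : ℂ} (hf : MeromorphicAt f z)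
    (h : ∀ᶠ x in 𝓝[≠] z, deriv f x ≠ 0) : ∀ᶠ x in 𝓝[≠] z, f x ≠ 0 := by
  refine hf.eventually_eq_zero_or_eventually_ne_zero.resolve_left fun h0 => ?_
  have hd : deriv f =ᶠ[𝓝[≠] z] deriv (fun _ => 0) :=
    EventuallyEq.nhdsNE_deriv h0
  obtain ⟨x, hx, hx'⟩ := (h.and hd).exists
  exact hx (by simpa using hx')

theorem eventually_iteratedDeriv_ne_zero (hD : IsConnected D) (hf : MeromorphicOn f D) {m : ℕ}
    (hne : ∃ z ∈ D, sphereValue (iteratedDeriv m f) z ≠ ((0 : ℂ) : OnePoint ℂ)) {j : ℕ}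
    (hj : j ≤ m) {w : ℂ} (hw : w ∈ D) : ∀ᶠ x in 𝓝[≠] w, iteratedDeriv j f x ≠ 0 := by
  induction hj using Nat.decreasingInduction with
  -- order `m`: the identity theorem on the connected set `D`
  | self =>
    have hmer := meromorphicOn_iteratedDeriv hf m
    obtain ⟨z, hz, hzne⟩ := hne
    rw [← meromorphicOrderAt_ne_top_iff_eventually_ne_zero (hmer w hw)]
    refine hmer.meromorphicOrderAt_ne_top_of_isPreconnected hD.isPreconnected hz hw fun htop => ?_
    rw [meromorphicOrderAt_eq_top_iff] at htop
    exact hzne (sphereValue_of_tendsto (tendsto_const_nhds.congr' (htop.mono fun _ h => h.symm)))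
  | of_succ j _ ih =>
    rw [iteratedDeriv_succ] at ih
    exact eventually_ne_zero_of_deriv (meromorphicOn_iteratedDeriv hf j w hw) ih

end IteratedDeriv

/-! ### Descending induction on the order of differentiation -/

theorem ConvergesLocallyUniformlyOn.exists_analytic {g : ℕ → ℂ → ℂ} {M : ℂ → ℂ} {S T : Set ℂ}
    (h : ConvergesLocallyUniformlyOn g (sphereValue M) S) (hM : MeromorphicOn M S) (hT : T ⊆ S)
    (hfin : ∀ z ∈ T, sphereValue M z ≠ OnePoint.infty) :
    ∃ G : ℂ → ℂ, AnalyticOnNhd ℂ G T ∧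
      ConvergesLocallyUniformlyOn g (fun z => (G z : OnePoint ℂ)) T :=
  ⟨regularize M, fun z hz => analyticAt_regularize (hM z (hT hz)) (hfin z hz),
    (h.mono hT).congr_right fun z hz => (coe_regularize (hfin z hz)).symm⟩

/-- The exceptional set after `i` steps has order `i`: each step adds the poles of the current limit,
and the limits of all higher quotients are finite off the exceptional set. -/
theorem exists_subseq_forall_converges {D : Set ℂ} (hD_open : IsOpen D) (hD_conn : IsConnected D)
    {m : ℕ} {f : ℕ → ℂ → ℂ} (hf : ∀ n, MeromorphicOn (f n) D)
    (hf_ne : ∀ n, ∃ z ∈ D, sphereValue (iteratedDeriv m (f n)) z ≠ ((0 : ℂ) : OnePoint ℂ))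
    {F : ℂ → ℂ} (hF : MeromorphicOn F D)
    (hconv : ConvergesLocallyUniformlyOn (fun n => logDerivOfOrder m (f n)) (sphereValue F) D)
    {i : ℕ} (hi : i ≤ m) :
    ∃ φ : ℕ → ℕ, StrictMono φ ∧ ∃ E, IsExceptional D i E ∧
      (∃ M : ℂ → ℂ, MeromorphicOn M (D \ E) ∧ ConvergesLocallyUniformlyOn
        (fun k => logDerivOfOrder (m - i) (f (φ k))) (sphereValue M) (D \ E)) ∧
      ∀ j ≤ m, m - i < j → ∃ G : ℂ → ℂ, AnalyticOnNhd ℂ G (D \ E) ∧ ConvergesLocallyUniformlyOn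
        (fun k => logDerivOfOrder j (f (φ k))) (fun z => (G z : OnePoint ℂ)) (D \ E) := by
  induction i with
  | zero =>
    exact ⟨id, strictMono_id, ∅, isExceptional_empty hD_open, ⟨F, by rwa [sdiff_empty],
      by simpa using hconv⟩, fun j hj hj' => absurd hj (not_le.mpr hj')⟩
  | succ i ih =>
    obtain ⟨φ, hφ, E, hE, ⟨M, hM, hMconv⟩, hG⟩ := ih (by omega)
    obtain ⟨E', hEE', hE', hfin⟩ := hE.exists_superset_poles hM
    have hsub : D \ E' ⊆ D \ E := sdiff_subset_sdiff_right hEE'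
    obtain ⟨G, hGan, hGconv⟩ := hMconv.exists_analytic hM hsub hfin
    obtain ⟨j, hj⟩ : ∃ j, m - i = j + 1 := ⟨m - i - 1, by omega⟩
    have hj' : m - (i + 1) = j := by omega
    have hGconv' : ConvergesLocallyUniformlyOn
        (fun k => logDeriv (deriv (iteratedDeriv j (f (φ k))))) (fun z => (G z : OnePoint ℂ))
        (D \ E') := by
      simpa only [hj, logDerivOfOrder_eq, iteratedDeriv_succ] using hGconv
    obtain ⟨ψ, hψ, M', hM', hM'conv⟩ := exists_subseq_logDeriv_converges hE'.isOpen_diff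
      (fun k => (meromorphicOn_iteratedDeriv (hf (φ k)) j).mono_set sdiff_subset)
      (fun k w hw => by
        rw [← iteratedDeriv_succ]
        exact eventually_iteratedDeriv_ne_zero hD_conn (hf (φ k)) (hf_ne (φ k)) (by omega) hw.1)
      hGan hGconv'
    refine ⟨φ ∘ ψ, hφ.comp hψ, E', hE', ⟨M', hM', ?_⟩, fun l hl hl' => ?_⟩
    · simpa only [hj', logDerivOfOrder_eq, Function.comp_apply] using hM'conv
    · rcases (show m - i = l ∨ m - i < l by omega) with rfl | hlt
      · exact ⟨G, hGan, hGconv.comp_strictMono hψ⟩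
      · obtain ⟨H, hH, hHconv⟩ := hG l hl hlt
        exact ⟨H, hH.mono hsub, (hHconv.mono hsub).comp_strictMono hψ⟩

theorem exists_subseq_const_or_strictMono (k : ℕ → ℕ) :
    ∃ ψ : ℕ → ℕ, StrictMono ψ ∧ ((∃ c, ∀ n, k (ψ n) = c) ∨ StrictMono (k ∘ ψ)) := by
  by_cases h : ∃ c, ∃ᶠ n in atTop, k n = c
  · obtain ⟨c, hc⟩ := h
    obtain ⟨ψ, hψ, hψc⟩ := extraction_of_frequently_atTop hc
    exact ⟨ψ, hψ, Or.inl ⟨c, hψc⟩⟩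
  · push Not at h
    have hk : Tendsto k atTop atTop := tendsto_atTop.mpr fun b => by
      filter_upwards [(eventually_all_finite (finite_Iio b)).mpr fun c _ => h c] with n hn
      exact not_lt.mp fun hlt => hn _ hlt rfl
    obtain ⟨ψ, hψ, hkψ⟩ := strictMono_subseq_of_tendsto_atTop hk
    exact ⟨ψ, hψ, Or.inr hkψ⟩

theorem convergesLocallyUniformlyOn_const (g : ℂ → ℂ) (S : Set ℂ) :
    ConvergesLocallyUniformlyOn (fun _ => g) (sphereValue g) S := fun ε hε z _ => by
  refine ⟨univ, univ_mem, Eventually.of_forall fun _ w _ => ?_⟩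
  have (x : OnePoint ℂ) : sphericalDist x x = 0 := by
    induction x using OnePoint.rec <;> simp [sphericalDist]
  rwa [this]

end LogDerivLift

end

theorem theorem1 (D : Set ℂ) (hD_open : IsOpen D) (hD_conn : IsConnected D)
    (m : ℕ) (hm : 1 ≤ m)
    (f : ℕ → ℂ → ℂ) (hf : ∀ n, MeromorphicOn (f n) D)
    -- `f_n^(m)` does not vanish identically, so that the quotients make sense
    (hf_ne : ∀ n, ∃ z ∈ D, LogDerivLift.sphereValue (iteratedDeriv m (f n)) z ≠ ((0 : ℂ) : OnePoint ℂ))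
    (F : ℂ → ℂ) (hF : MeromorphicOn F D)
    (hconv : LogDerivLift.ConvergesLocallyUniformlyOn
      (fun n => LogDerivLift.logDerivOfOrder m (f n)) (LogDerivLift.sphereValue F) D) :
    (∀ j ≤ m, LogDerivLift.IsQNormal (m - j) D
      (Set.range fun n => LogDerivLift.logDerivOfOrder j (f n))) ∧
    ∃ φ : ℕ → ℕ, StrictMono φ ∧
      ∃ U : Set ℂ, IsOpen U ∧ U ⊆ D ∧ D ⊆ closure U ∧
        ∀ j ≤ m, ∃ G : ℂ → ℂ, AnalyticOnNhd ℂ G U ∧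
          LogDerivLift.ConvergesLocallyUniformlyOn
            (fun k => LogDerivLift.logDerivOfOrder j (f (φ k))) (fun z => (G z : OnePoint ℂ)) U := by
  open LogDerivLift in
  refine ⟨fun j hj => ⟨?_, fun u hu => ?_⟩, ?_⟩
  · rintro _ ⟨n, rfl⟩
    exact (meromorphicOn_iteratedDeriv (hf n) (j + 1)).div (meromorphicOn_iteratedDeriv (hf n) j)
  · choose k hk using hu
    -- a sequence in the family may repeat one member infinitely often
    obtain ⟨ψ, hψ, ⟨c, hc⟩ | hkψ⟩ := exists_subseq_const_or_strictMono k
    · refine ⟨∅, Set.empty_subset D, derivedSetIn_empty, ψ, hψ,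
        sphereValue (logDerivOfOrder j (f c)), ?_⟩
      have : (fun n => u (ψ n)) = fun _ => logDerivOfOrder j (f c) := by
        funext n
        rw [← hk, hc]
      rw [this]
      exact convergesLocallyUniformlyOn_const _ _
    · obtain ⟨φ, hφ, E, hE, ⟨M, -, hM⟩, -⟩ := exists_subseq_forall_converges hD_open hD_conn
        (fun n => hf (k (ψ n))) (fun n => hf_ne (k (ψ n))) hF (hconv.comp_strictMono hkψ)
        (Nat.sub_le m j)
      refine ⟨E, hE.subset, hE.derivedSetIn_eq, ψ ∘ φ, hψ.comp hφ, sphereValue M, ?_⟩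
      simpa only [Nat.sub_sub_self hj, hk, Function.comp_apply] using hM
  · obtain ⟨φ, hφ, E, hE, ⟨M, hM, hMconv⟩, hG⟩ :=
      exists_subseq_forall_converges hD_open hD_conn hf hf_ne hF hconv le_rfl
    obtain ⟨E', hEE', hE', hfin⟩ := hE.exists_superset_poles hM
    have hsub : D \ E' ⊆ D \ E := Set.sdiff_subset_sdiff_right hEE'
    refine ⟨φ, hφ, D \ E', hE'.isOpen_diff, Set.sdiff_subset, hE'.subset_closure, fun j hj => ?_⟩
    rcases Nat.eq_zero_or_pos j with rfl | hpos
    · exact ConvergesLocallyUniformlyOn.exists_analytic (by simpa using hMconv) hM hsub hfin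
    · obtain ⟨G, hGan, hGconv⟩ := hG j hj (by omega)
      exact ⟨G, hGan.mono hsub, hGconv.mono hsub⟩
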